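/- Let $q,\alpha,\beta\in\mathbb{C}$ with $|q|<1$, $|\alpha|<1$, $|\beta|<1$. Write $(a;q)_n=\prod_{k=0}^{n-1}(1-aq^k)$ for $n\ge 0$ (with $(a;q)_0=1$), $(a;q)_\infty=\prod_{k=0}^{\infty}(1-aq^k)$, and $(a,b;q)_\infty=(a;q)_\infty(b;q)_\infty$. For $\theta\in\mathbb{R}$ let the functions $C_n^{(\alpha,\beta)}(e^{i\theta};q)$, $n\ge 0$, be defined by the generating function $$\frac{(\alpha te^{i\theta},\beta te^{-i\theta};q)_\infty}{(te^{i\theta},te^{-i\theta};q)_\infty}=\sum_{n=0}^{\infty}C_n^{(\alpha,\beta)}(e^{i\theta};q)\,t^n,\qquad |t|<1,$$ that is, $C_n^{(\alpha,\beta)}(e^{i\theta};q)$ is the $n$-th Taylor coefficient at $t=0$ of the left-hand side, whose Taylor series converges to it for $|t|<1$. Then for all integers $m,n\ge 0$ the integrand below is integrable on $[0,2\pi]$, and $$\int_{0}^{2\pi}C_m^{(\alpha,\beta)}(e^{i\theta};q)\,C_n^{(\alpha,\beta)}(e^{i\theta};q)\,\frac{(e^{2i\theta},e^{-2i\theta};q)_\infty}{(\alpha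 e^{2i\theta},\beta e^{-2i\theta};q)_\infty}\,d\theta =\frac{2\pi(\alpha,\beta;q)_\infty}{(q,\alpha\beta;q)_\infty}\left(\frac{1}{1-\alpha q^n}+\frac{1}{1-\beta q^n}\right)\frac{(\alpha\beta;q)_n}{(q;q)_n}\,\delta_{m,n},$$ where $\delta_{m,n}=1$ if $m=n$ and $0$ otherwise. -/

import Mathlib

namespace QOrth

/-- The finite `q`-shifted factorial `(a;q)_n = ∏_{k=0}^{n-1} (1 - a q^k)`. -/
noncomputable def qPoch (a q : ℂ) (n : ℕ) : ℂ :=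
  ∏ k ∈ Finset.range n, (1 - a * q ^ k)

/-- The infinite `q`-shifted factorial `(a;q)_∞ = ∏_{k=0}^∞ (1 - a q^k)`
(the product converges unconditionally for `|q| < 1`). -/
noncomputable def qPochInf (a q : ℂ) : ℂ :=
  ∏' k : ℕ, (1 - a * q ^ k)

/-- The generating function
`(α t z, β t z⁻¹; q)_∞ / (t z, t z⁻¹; q)_∞`, to be used with `z = e^{iθ}`. -/
noncomputable def genFun (α β q z t : ℂ) : ℂ :=
  (qPochInf (α * t * z) q * qPochInf (β * t * z⁻¹) q) /
    (qPochInf (t * z) q * qPochInf (t * z⁻¹) q)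

/-- `C_n^{(α,β)}(z;q)`: the coefficient of `t^n` in the expansion of the generating function
in powers of `t`, i.e. its `n`-th Taylor coefficient at `t = 0`. -/
noncomputable def C (α β q : ℂ) (n : ℕ) (z : ℂ) : ℂ :=
  iteratedDeriv n (genFun α β q z) 0 / (n.factorial : ℂ)

/-- The weight `(e^{2iθ}, e^{-2iθ}; q)_∞ / (α e^{2iθ}, β e^{-2iθ}; q)_∞`. -/
noncomputable def weight (α β q : ℂ) (θ : ℝ) : ℂ :=
  (qPochInf (Complex.exp (2 * Complex.I * θ)) q *
      qPochInf (Complex.exp (-2 * Complex.I * θ)) q) /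
    (qPochInf (α * Complex.exp (2 * Complex.I * θ)) q *
      qPochInf (β * Complex.exp (-2 * Complex.I * θ)) q)

end QOrth

/-
By the `q`-binomial theorem, `C_n (z; α, β)` is `z⁻ⁿ` times a polynomial of degree `n` in `x = z²`
(Pastro's polynomial), and the weight is `1 - x⁻¹` times the kernel of Ramanujan's `₁ψ₁` sum. Let
`μ_n (j; α, β)` be the average over the unit circle of the polynomial times the kernel times
`x ^ j`.

Shifting the contour by `x ↦ q x` gives a first-order recurrence for the Fourier coefficients of the
kernel. Together with the contiguous relations of the `q`-binomial coefficients it yields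
`(1 - q ^ (n + 1)) μ_{n+1} (j; α, β) = (1 - q ^ (n + 1 + j)) μ_n (j; α q, β)`.
The factor on the right vanishes at `j = -n - 1`, so by induction `μ_n (j; α, β) = 0` for
`-n ≤ j < 0`, which is the orthogonality. At `j = 0` the relation reduces the norm to the constant
term of the kernel, computed by iterating `β ↦ β q` and comparing with the trivial case `β = q`.
-/

namespace QOrth

open Complex Filter Finset MeasureTheory Metric Topology
open scoped Real

section QShiftedFactorial

variable {a b q x : ℂ}

theorem norm_mul_pow_lt_one (hq : ‖q‖ < 1) (ha : ‖a‖ < 1) (k : ℕ) : ‖a * q ^ k‖ < 1 := by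
  rw [norm_mul, norm_pow]
  exact (mul_le_of_le_one_right (norm_nonneg _) (pow_le_one₀ (norm_nonneg _) hq.le)).trans_lt ha

theorem one_sub_mul_pow_ne_zero (hq : ‖q‖ < 1) (ha : ‖a‖ < 1) (k : ℕ) : 1 - a * q ^ k ≠ 0 :=
  (isUnit_one_sub_of_norm_lt_one (norm_mul_pow_lt_one hq ha k)).ne_zero

theorem one_sub_pow_succ_ne_zero (hq : ‖q‖ < 1) (k : ℕ) : 1 - q ^ (k + 1) ≠ 0 := by
  rw [pow_succ']
  exact one_sub_mul_pow_ne_zero hq hq k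

@[simp]
theorem qPoch_zero (a q : ℂ) : qPoch a q 0 = 1 := prod_range_zero _

theorem qPoch_succ (a q : ℂ) (n : ℕ) : qPoch a q (n + 1) = qPoch a q n * (1 - a * q ^ n) :=
  prod_range_succ _ n

theorem qPoch_ne_zero (hq : ‖q‖ < 1) (ha : ‖a‖ < 1) (n : ℕ) : qPoch a q n ≠ 0 :=
  prod_ne_zero_iff.mpr fun k _ => one_sub_mul_pow_ne_zero hq ha k

theorem norm_qPoch_le (hq : ‖q‖ < 1) (a : ℂ) (n : ℕ) :
    ‖qPoch a q n‖ ≤ Real.exp (‖a‖ * (1 - ‖q‖)⁻¹) := by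
  have hsum : ∑ k ∈ range n, ‖q‖ ^ k ≤ (1 - ‖q‖)⁻¹ := by
    rw [← tsum_geometric_of_lt_one (norm_nonneg q) hq]
    exact (summable_geometric_of_lt_one (norm_nonneg q) hq).sum_le_tsum _
      fun k _ => by positivity
  calc ‖qPoch a q n‖ = ∏ k ∈ range n, ‖1 - a * q ^ k‖ := norm_prod _ _
    _ ≤ ∏ k ∈ range n, Real.exp (‖a‖ * ‖q‖ ^ k) := by
      refine prod_le_prod (fun _ _ => norm_nonneg _) fun k _ => ?_
      calc ‖1 - a * q ^ k‖ ≤ ‖a‖ * ‖q‖ ^ k + 1 := by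
            simpa [add_comm] using norm_sub_le 1 (a * q ^ k)
        _ ≤ Real.exp (‖a‖ * ‖q‖ ^ k) := Real.add_one_le_exp _
    _ = Real.exp (‖a‖ * ∑ k ∈ range n, ‖q‖ ^ k) := by rw [← Real.exp_sum, mul_sum]
    _ ≤ Real.exp (‖a‖ * (1 - ‖q‖)⁻¹) := by gcongr

theorem summable_norm_neg_mul_pow (hq : ‖q‖ < 1) (a : ℂ) :
    Summable fun k : ℕ => ‖-(a * q ^ k)‖ := by
  simpa only [norm_neg, norm_mul, norm_pow] using
    (summable_geometric_of_lt_one (norm_nonneg q) hq).mul_left ‖a‖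

theorem multipliable_one_sub_mul_pow (hq : ‖q‖ < 1) (a : ℂ) :
    Multipliable fun k : ℕ => 1 - a * q ^ k := by
  simpa only [sub_eq_add_neg] using
    multipliable_one_add_of_summable (summable_norm_neg_mul_pow hq a)

theorem tendsto_qPoch (hq : ‖q‖ < 1) (a : ℂ) :
    Tendsto (qPoch a q) atTop (𝓝 (qPochInf a q)) :=
  (multipliable_one_sub_mul_pow hq a).tendsto_prod_tprod_nat

@[simp]
theorem qPochInf_zero (q : ℂ) : qPochInf 0 q = 1 := by simp [qPochInf]

theorem qPochInf_ne_zero (hq : ‖q‖ < 1) (ha : ‖a‖ < 1) : qPochInf a q ≠ 0 := by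
  have := tprod_one_add_ne_zero_of_summable (f := fun k : ℕ => -(a * q ^ k))
    (fun k => by simpa only [sub_eq_add_neg] using one_sub_mul_pow_ne_zero hq ha k)
    (summable_norm_neg_mul_pow hq a)
  simpa only [qPochInf, sub_eq_add_neg] using this

theorem qPochInf_eq_qPoch_mul (hq : ‖q‖ < 1) (a : ℂ) (n : ℕ) :
    qPochInf a q = qPoch a q n * qPochInf (a * q ^ n) q := by
  have := (Multipliable.prod_mul_tprod_nat_mul' (f := fun k : ℕ => 1 - a * q ^ k) (k := n)
    (by simpa only [pow_add, mul_assoc, mul_comm (q ^ n)] using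
      multipliable_one_sub_mul_pow hq (a * q ^ n))).symm
  simpa only [qPochInf, qPoch, pow_add, mul_assoc, mul_comm (q ^ n)] using this

theorem qPochInf_eq_one_sub_mul (hq : ‖q‖ < 1) (a : ℂ) :
    qPochInf a q = (1 - a) * qPochInf (a * q) q := by
  simpa [qPoch] using qPochInf_eq_qPoch_mul hq a 1

end QShiftedFactorial

section QBinomialTheorem

variable {a b q x : ℂ}

/-- The quotient `(a x; q)_∞ / (b x; q)_∞`, which the `q`-binomial theorem expands in powers
of `x`. -/
noncomputable def qRatio (a b q x : ℂ) : ℂ :=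
  qPochInf (a * x) q / qPochInf (b * x) q

/-- The coefficient of `x ^ k` in the expansion of `qRatio a b q x`. It is usually written
`b ^ k * (a / b; q)_k / (q; q)_k`; the form chosen here also makes sense for `b = 0`. -/
noncomputable def qRatioCoeff (a b q : ℂ) (k : ℕ) : ℂ :=
  (∏ l ∈ range k, (b - a * q ^ l)) / qPoch q q k

@[simp]
theorem qRatioCoeff_zero (a b q : ℂ) : qRatioCoeff a b q 0 = 1 := by simp [qRatioCoeff]

theorem qRatioCoeff_one_right (a q : ℂ) (k : ℕ) :
    qRatioCoeff a 1 q k = qPoch a q k / qPoch q q k := rfl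

theorem qRatioCoeff_succ (hq : ‖q‖ < 1) (a b : ℂ) (k : ℕ) :
    (1 - q ^ (k + 1)) * qRatioCoeff a b q (k + 1) = (b - a * q ^ k) * qRatioCoeff a b q k := by
  have hk := qPoch_ne_zero hq hq k
  have hk' := one_sub_pow_succ_ne_zero hq k
  rw [qRatioCoeff, qRatioCoeff, qPoch_succ, prod_range_succ, ← pow_succ']
  field_simp

theorem sub_mul_qRatioCoeff_mul_left (a b q : ℂ) (k : ℕ) :
    (b - a) * qRatioCoeff (a * q) b q k = (b - a * q ^ k) * qRatioCoeff a b q k := by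
  have h := (prod_range_succ' (fun l => b - a * q ^ l) k).symm.trans (prod_range_succ _ k)
  simp only [pow_succ', pow_zero, mul_one, ← mul_assoc] at h
  rw [qRatioCoeff, qRatioCoeff, mul_div_assoc', mul_div_assoc', mul_comm (b - a), h, mul_comm]

theorem qRatioCoeff_mul_left_succ (hq : ‖q‖ < 1) (a b : ℂ) (k : ℕ) :
    qRatioCoeff (a * q) b q (k + 1) - q ^ (k + 1) * qRatioCoeff a b q (k + 1) =
      b * qRatioCoeff (a * q) b q k := by
  refine mul_left_cancel₀ (one_sub_pow_succ_ne_zero hq k) ?_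
  linear_combination qRatioCoeff_succ hq (a * q) b k - q ^ (k + 1) * qRatioCoeff_succ hq a b k +
    q ^ (k + 1) * sub_mul_qRatioCoeff_mul_left a b q k

theorem summable_norm_qRatioCoeff_mul_pow (hq : ‖q‖ < 1) (a : ℂ) (hx : ‖b * x‖ < 1) :
    Summable fun k : ℕ => ‖qRatioCoeff a b q k * x ^ k‖ := by
  obtain ⟨r, hr, hr1⟩ := exists_between hx
  have hq0 : Tendsto (fun k : ℕ => q ^ k) atTop (𝓝 0) :=
    tendsto_pow_atTop_nhds_zero_of_norm_lt_one hq
  have hlim : Tendsto (fun k : ℕ => ‖(b - a * q ^ k) / (1 - q ^ (k + 1)) * x‖) atTop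
      (𝓝 ‖(b - a * 0) / (1 - 0) * x‖) :=
    ((((hq0.const_mul a).const_sub b).div ((hq0.comp (tendsto_add_atTop_nat 1)).const_sub 1)
      (by simp)).mul_const x).norm
  refine summable_of_ratio_norm_eventually_le hr1 ?_
  filter_upwards [hlim.eventually_lt_const (u := r) (by simpa using hr)] with k hk
  have hratio : qRatioCoeff a b q (k + 1) * x ^ (k + 1) =
      (b - a * q ^ k) / (1 - q ^ (k + 1)) * x * (qRatioCoeff a b q k * x ^ k) := by
    have hk' := one_sub_pow_succ_ne_zero hq k
    field_simp
    linear_combination x ^ (k + 1) * qRatioCoeff_succ hq a b k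
  rw [norm_norm, norm_norm, hratio, norm_mul]
  gcongr

theorem summable_norm_qRatioCoeff (hq : ‖q‖ < 1) (a : ℂ) (hb : ‖b‖ < 1) :
    Summable fun k => ‖qRatioCoeff a b q k‖ := by
  simpa using summable_norm_qRatioCoeff_mul_pow (x := 1) hq a (by simpa using hb)

theorem one_sub_mul_tsum_qRatioCoeff (hq : ‖q‖ < 1) (a : ℂ) (hx : ‖b * x‖ < 1) :
    (1 - b * x) * ∑' k, qRatioCoeff a b q k * x ^ k =
      (1 - a * x) * ∑' k, qRatioCoeff a b q k * (x * q) ^ k := by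
  have hxq : ‖b * (x * q)‖ < 1 := by
    simpa [mul_assoc] using norm_mul_pow_lt_one hq hx 1
  have s := (summable_norm_qRatioCoeff_mul_pow hq a hx).of_norm
  have s' := (summable_norm_qRatioCoeff_mul_pow hq a hxq).of_norm
  have hdiff : ∑' k, qRatioCoeff a b q (k + 1) * x ^ (k + 1) -
      ∑' k, qRatioCoeff a b q (k + 1) * (x * q) ^ (k + 1) =
      b * x * (∑' k, qRatioCoeff a b q k * x ^ k) -
        a * x * ∑' k, qRatioCoeff a b q k * (x * q) ^ k := by
    rw [← ((summable_nat_add_iff 1).mpr s).tsum_sub ((summable_nat_add_iff 1).mpr s'),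
      ← tsum_mul_left, ← tsum_mul_left, ← (s.mul_left _).tsum_sub (s'.mul_left _)]
    refine tsum_congr fun k => ?_
    rw [mul_pow, mul_pow]
    linear_combination x ^ (k + 1) * qRatioCoeff_succ hq a b k
  have e := s.tsum_eq_zero_add
  have e' := s'.tsum_eq_zero_add
  simp only [pow_zero, mul_one] at e e'
  linear_combination e - e' + hdiff

theorem qPoch_mul_tsum_qRatioCoeff (hq : ‖q‖ < 1) (a : ℂ) (hx : ‖b * x‖ < 1) (n : ℕ) :
    qPoch (b * x) q n * ∑' k, qRatioCoeff a b q k * x ^ k =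
      qPoch (a * x) q n * ∑' k, qRatioCoeff a b q k * (x * q ^ n) ^ k := by
  induction n with
  | zero => simp
  | succ n ih =>
    have h := one_sub_mul_tsum_qRatioCoeff (x := x * q ^ n) hq a
      (by simpa only [mul_assoc] using norm_mul_pow_lt_one hq hx n)
    rw [mul_assoc x, ← pow_succ] at h
    rw [qPoch_succ, qPoch_succ]
    linear_combination (1 - b * x * q ^ n) * ih + qPoch (a * x) q n * h

theorem tendsto_tsum_qRatioCoeff (hq : ‖q‖ < 1) (a : ℂ) (hx : ‖b * x‖ < 1) :
    Tendsto (fun n : ℕ => ∑' k, qRatioCoeff a b q k * (x * q ^ n) ^ k) atTop (𝓝 1) := by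
  rw [show (1 : ℂ) = ∑' k : ℕ, if k = 0 then 1 else 0 by simp]
  refine tendsto_tsum_of_dominated_convergence (summable_norm_qRatioCoeff_mul_pow hq a hx)
    (fun k => ?_) (.of_forall fun n k => ?_)
  · have hq0 : Tendsto (fun n : ℕ => x * q ^ n) atTop (𝓝 (x * 0)) :=
      (tendsto_pow_atTop_nhds_zero_of_norm_lt_one hq).const_mul x
    cases k with
    | zero => simp
    | succ k => simpa using (hq0.pow (k + 1)).const_mul (qRatioCoeff a b q (k + 1))
  · rw [norm_mul, norm_mul, norm_pow, norm_pow, norm_mul, norm_pow]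
    gcongr
    exact mul_le_of_le_one_right (norm_nonneg _) (pow_le_one₀ (norm_nonneg _) hq.le)

theorem hasSum_qRatio (hq : ‖q‖ < 1) (a : ℂ) (hx : ‖b * x‖ < 1) :
    HasSum (fun k => qRatioCoeff a b q k * x ^ k) (qRatio a b q x) := by
  have hlim : qPochInf (b * x) q * ∑' k, qRatioCoeff a b q k * x ^ k = qPochInf (a * x) q * 1 :=
    tendsto_nhds_unique ((tendsto_qPoch hq (b * x)).mul_const _)
      (((tendsto_qPoch hq (a * x)).mul (tendsto_tsum_qRatioCoeff hq a hx)).congr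
        fun n => (qPoch_mul_tsum_qRatioCoeff hq a hx n).symm)
  rw [qRatio, ← mul_one (qPochInf (a * x) q), ← hlim,
    mul_div_cancel_left₀ _ (qPochInf_ne_zero hq hx)]
  exact (summable_norm_qRatioCoeff_mul_pow hq a hx).of_norm.hasSum

theorem qRatio_comp_mul (a b c q x : ℂ) : qRatio a b q (c * x) = qRatio (a * c) (b * c) q x := by
  simp only [qRatio, mul_assoc]

theorem qRatio_eq_one_sub_mul (hq : ‖q‖ < 1) (a b x : ℂ) :
    qRatio a b q x = (1 - a * x) * qRatio (a * q) b q x := by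
  rw [qRatio, qPochInf_eq_one_sub_mul hq (a * x), qRatio, mul_div_assoc, mul_right_comm a]

theorem qRatio_mul_pow (hq : ‖q‖ < 1) (a : ℂ) (hx : ‖b * x‖ < 1) (n : ℕ) :
    qRatio a (b * q ^ n) q x = qPoch (b * x) q n * qRatio a b q x := by
  have hn := qPoch_ne_zero hq hx n
  rw [qRatio, qRatio, qPochInf_eq_qPoch_mul hq (b * x) n, mul_right_comm b (q ^ n) x,
    mul_div_assoc', mul_div_mul_left _ _ hn]

theorem qRatio_mul_right (hq : ‖q‖ < 1) (a : ℂ) (hx : ‖b * x‖ < 1) :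
    qRatio a (b * q) q x = (1 - b * x) * qRatio a b q x := by
  simpa [qPoch] using qRatio_mul_pow hq a hx 1

theorem qRatio_zero_right (hq : ‖q‖ < 1) (a : ℂ) (hx : ‖b * x‖ < 1) :
    qRatio a 0 q x = qPochInf (b * x) q * qRatio a b q x := by
  rw [qRatio, qRatio, zero_mul, qPochInf_zero, div_one,
    mul_div_cancel₀ _ (qPochInf_ne_zero hq hx)]

theorem norm_mul_lt_one (hb : ‖b‖ < 1) (hx : ‖x‖ ≤ 1) : ‖b * x‖ < 1 := by
  rw [norm_mul]
  exact (mul_le_of_le_one_right (norm_nonneg b) hx).trans_lt hb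

theorem continuousOn_qRatio (hq : ‖q‖ < 1) (a : ℂ) (hb : ‖b‖ < 1) :
    ContinuousOn (qRatio a b q) (closedBall 0 1) := by
  have hseries : ContinuousOn (fun x => ∑' k, qRatioCoeff a b q k * x ^ k) (closedBall 0 1) := by
    refine continuousOn_tsum (fun k => by fun_prop) (summable_norm_qRatioCoeff hq a hb)
      fun k x hx => ?_
    rw [norm_mul, norm_pow]
    exact mul_le_of_le_one_right (norm_nonneg _)
      (pow_le_one₀ (norm_nonneg x) (mem_closedBall_zero_iff.mp hx))
  exact hseries.congr fun x hx =>
    (hasSum_qRatio hq a (norm_mul_lt_one hb (mem_closedBall_zero_iff.mp hx))).tsum_eq.symm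

end QBinomialTheorem

section CircleMoment

/-- The average of `f x * x ^ j` over the unit circle, that is, the Fourier coefficient of
index `-j` of `f`. -/
noncomputable def circleMoment (f : ℂ → ℂ) (j : ℤ) : ℂ :=
  Real.circleAverage (fun x => f x * x ^ j) 0 1

variable {f g : ℂ → ℂ} {j : ℤ}

theorem continuousOn_zpow_sphere (j : ℤ) : ContinuousOn (fun x : ℂ => x ^ j) (sphere 0 1) :=
  continuousOn_id.zpow₀ j fun _ hx => .inl (ne_of_mem_sphere hx one_ne_zero)

theorem circleIntegrable_mul_zpow (hf : ContinuousOn f (sphere 0 1)) (j : ℤ) :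
    CircleIntegrable (fun x => f x * x ^ j) 0 1 :=
  (hf.mul (continuousOn_zpow_sphere j)).circleIntegrable zero_le_one

theorem circleAverage_zpow (n : ℤ) :
    Real.circleAverage (fun x : ℂ => x ^ n) 0 1 = if n = 0 then 1 else 0 := by
  split_ifs with hn
  · simp [hn, Real.circleAverage_const]
  · have hint : (∮ x in C(0, 1), (x - 0)⁻¹ • x ^ n) = ∮ x in C(0, 1), (x - 0) ^ (n - 1) :=
      circleIntegral.integral_congr zero_le_one fun x hx => by
        simp [zpow_sub_one₀ (ne_of_mem_sphere hx one_ne_zero), mul_comm]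
    rw [Real.circleAverage_eq_circleIntegral one_ne_zero, hint,
      circleIntegral.integral_sub_zpow_of_ne (by omega), smul_zero]

theorem circleMoment_zpow (k j : ℤ) :
    circleMoment (fun x => x ^ k) j = if k + j = 0 then 1 else 0 := by
  rw [← circleAverage_zpow]
  exact Real.circleAverage_congr_sphere fun x hx =>
    (zpow_add₀ (ne_of_mem_sphere hx (by simp)) k j).symm

theorem circleMoment_congr (h : Set.EqOn f g (sphere 0 1)) (j : ℤ) :
    circleMoment f j = circleMoment g j :=
  Real.circleAverage_congr_sphere fun x hx => by
    simp only [h (by simpa only [abs_one] using hx)]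

theorem circleMoment_comp_inv (f : ℂ → ℂ) (j : ℤ) :
    circleMoment (fun x => f x⁻¹) j = circleMoment f (-j) := by
  rw [circleMoment, circleMoment, ← Real.circleAverage_zero_one_congr_inv]
  simp only [inv_inv, inv_zpow']

theorem circleMoment_zpow_mul (f : ℂ → ℂ) (k j : ℤ) :
    circleMoment (fun x => x ^ k * f x) j = circleMoment f (j + k) :=
  Real.circleAverage_congr_sphere fun x hx => by
    simp only [zpow_add₀ (ne_of_mem_sphere hx (by simp))]
    ring

theorem circleMoment_const_mul (c : ℂ) (f : ℂ → ℂ) (j : ℤ) :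
    circleMoment (fun x => c * f x) j = c * circleMoment f j := by
  simp only [circleMoment, mul_assoc]
  exact Real.circleAverage_fun_smul (a := c)

theorem circleMoment_sub (hf : ContinuousOn f (sphere 0 1)) (hg : ContinuousOn g (sphere 0 1))
    (j : ℤ) : circleMoment (fun x => f x - g x) j = circleMoment f j - circleMoment g j := by
  simp only [circleMoment, sub_mul]
  exact Real.circleAverage_fun_sub (circleIntegrable_mul_zpow hf j) (circleIntegrable_mul_zpow hg j)

theorem circleMoment_sum {ι : Type*} (s : Finset ι) {f : ι → ℂ → ℂ}
    (hf : ∀ i, ContinuousOn (f i) (sphere 0 1)) (j : ℤ) :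
    circleMoment (fun x => ∑ i ∈ s, f i x) j = ∑ i ∈ s, circleMoment (f i) j := by
  simp only [circleMoment, sum_mul]
  exact Real.circleAverage_fun_sum fun i _ => circleIntegrable_mul_zpow (hf i) j

theorem circleMoment_one_sub_mul (hf : ContinuousOn f (sphere 0 1)) (c : ℂ) (k j : ℤ) :
    circleMoment (fun x => (1 - c * x ^ k) * f x) j =
      circleMoment f j - c * circleMoment f (j + k) := by
  simp only [sub_mul, one_mul, mul_assoc]
  rw [circleMoment_sub (g := fun x => c * (x ^ k * f x)) hf
    (((continuousOn_zpow_sphere k).mul hf).const_mul c), circleMoment_const_mul,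
    circleMoment_zpow_mul]

theorem circleMoment_sum_mul {ι : Type*} (s : Finset ι) (c : ι → ℂ) (e : ι → ℤ)
    (hf : ContinuousOn f (sphere 0 1)) (j : ℤ) :
    circleMoment (fun x => (∑ i ∈ s, c i * x ^ e i) * f x) j =
      ∑ i ∈ s, c i * circleMoment f (j + e i) := by
  simp only [sum_mul, mul_assoc]
  rw [circleMoment_sum s (f := fun i x => c i * (x ^ e i * f x))
    fun i => ((continuousOn_zpow_sphere (e i)).mul hf).const_mul (c i)]
  simp only [circleMoment_const_mul, circleMoment_zpow_mul]

theorem circleAverage_comp_sq (hf : CircleIntegrable f 0 1) :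
    Real.circleAverage (fun z => f (z ^ 2)) 0 1 = Real.circleAverage f 0 1 := by
  have hperiodic : Function.Periodic (fun θ => f (circleMap 0 1 θ)) (2 * π) :=
    (periodic_circleMap 0 1).comp f
  have htwice : ∫ θ in 0..2 * (2 * π), f (circleMap 0 1 θ) =
      2 * ∫ θ in 0..2 * π, f (circleMap 0 1 θ) := by
    simpa using hperiodic.intervalIntegral_add_zsmul_eq 2 0
      (hperiodic.intervalIntegrable₀ Real.two_pi_pos.ne' hf)
  have hsq (θ : ℝ) : circleMap 0 1 θ ^ 2 = circleMap 0 1 (2 * θ) := by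
    simpa using circleMap_zero_pow 2 1 θ
  simp only [Real.circleAverage_def, hsq]
  rw [intervalIntegral.integral_comp_mul_left (fun θ => f (circleMap 0 1 θ)) two_ne_zero,
    mul_zero, htwice]
  simp

theorem circleMoment_comp_sq_two_mul (hf : ContinuousOn f (sphere 0 1)) (j : ℤ) :
    circleMoment (fun z => f (z ^ 2)) (2 * j) = circleMoment f j := by
  rw [circleMoment, circleMoment, ← circleAverage_comp_sq (circleIntegrable_mul_zpow hf j)]
  simp only [zpow_mul, zpow_ofNat]

theorem circleMoment_comp_sq_of_odd (f : ℂ → ℂ) (hj : Odd j) :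
    circleMoment (fun z => f (z ^ 2)) j = 0 := by
  have hneg (θ : ℝ) : circleMap 0 1 (θ + π) = -circleMap 0 1 θ := by
    simp [circleMap, add_mul, exp_add]
  refine self_eq_neg.mp ?_
  conv_lhs => rw [circleMoment, Real.circleAverage_eq_integral_add π]
  simp only [hneg, neg_sq, hj.neg_zpow, mul_neg, intervalIntegral.integral_neg, smul_neg]
  rfl

theorem hasSum_circleMoment {ι : Type*} [Countable ι] {u : ι → ℂ → ℂ} {b : ι → ℝ}
    (hu : ∀ i, ContinuousOn (u i) (sphere 0 1)) (hb : Summable b)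
    (hub : ∀ i, ∀ x ∈ sphere (0 : ℂ) 1, ‖u i x‖ ≤ b i)
    (hf : ∀ x ∈ sphere (0 : ℂ) 1, HasSum (fun i => u i x) (f x)) (j : ℤ) :
    HasSum (fun i => circleMoment (u i) j) (circleMoment f j) := by
  refine (intervalIntegral.hasSum_integral_of_dominated_convergence (fun i _ => b i)
    (fun i => (circleIntegrable_mul_zpow (hu i) j).aestronglyMeasurable_restrict_uIoc)
    (fun i => .of_forall fun θ _ => ?_) (.of_forall fun _ _ => hb)
    intervalIntegrable_const (.of_forall fun θ _ => ?_)).const_smul _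
  · rw [norm_mul, norm_zpow, norm_circleMap_zero, abs_one, one_zpow, mul_one]
    exact hub i _ (circleMap_mem_sphere _ zero_le_one _)
  · exact (hf _ (circleMap_mem_sphere _ zero_le_one _)).mul_right _

theorem tendsto_circleMoment {u : ℕ → ℂ → ℂ} {B : ℝ}
    (hu : ∀ n, ContinuousOn (u n) (sphere 0 1)) (hub : ∀ n, ∀ x ∈ sphere (0 : ℂ) 1, ‖u n x‖ ≤ B)
    (hf : ∀ x ∈ sphere (0 : ℂ) 1, Tendsto (fun n => u n x) atTop (𝓝 (f x))) (j : ℤ) :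
    Tendsto (fun n => circleMoment (u n) j) atTop (𝓝 (circleMoment f j)) := by
  refine (intervalIntegral.tendsto_integral_filter_of_dominated_convergence (fun _ => B)
    (.of_forall fun n => (circleIntegrable_mul_zpow (hu n) j).aestronglyMeasurable_restrict_uIoc)
    (.of_forall fun n => .of_forall fun θ _ => ?_) intervalIntegrable_const
    (.of_forall fun θ _ => ?_)).const_smul _
  · rw [norm_mul, norm_zpow, norm_circleMap_zero, abs_one, one_zpow, mul_one]
    exact hub n _ (circleMap_mem_sphere _ zero_le_one _)
  · exact (hf _ (circleMap_mem_sphere _ zero_le_one _)).mul_const _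

theorem hasSum_circleMoment_mul_comp_inv {c d : ℕ → ℂ}
    (hc : Summable fun k => ‖c k‖) (hd : Summable fun l => ‖d l‖)
    (hf : ∀ x ∈ sphere (0 : ℂ) 1, HasSum (fun k => c k * x ^ k) (f x))
    (hg : ∀ x ∈ sphere (0 : ℂ) 1, HasSum (fun l => d l * x ^ l) (g x)) (j : ℤ) :
    HasSum (fun p : ℕ × ℕ => if p.1 - p.2 + j = 0 then c p.1 * d p.2 else 0)
      (circleMoment (fun x => f x * g x⁻¹) j) := by
  have hlaurent (x : ℂ) (hx : x ∈ sphere (0 : ℂ) 1) :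
      HasSum (fun p : ℕ × ℕ => c p.1 * d p.2 * x ^ (p.1 - p.2 : ℤ)) (f x * g x⁻¹) := by
    have hfx : Summable fun k => ‖c k * x ^ k‖ := by
      simpa [mem_sphere_zero_iff_norm.mp hx] using hc
    have hgx : Summable fun l => ‖d l * x⁻¹ ^ l‖ := by
      simpa [mem_sphere_zero_iff_norm.mp hx] using hd
    have hgx' : HasSum (fun l => d l * x⁻¹ ^ l) (g x⁻¹) := hg x⁻¹ (by simpa using hx)
    refine ((hf x hx).mul hgx' (summable_mul_of_summable_norm (f := fun k => c k * x ^ k)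
      (g := fun l => d l * x⁻¹ ^ l) hfx hgx)).congr_fun fun p => ?_
    rw [zpow_sub₀ (ne_of_mem_sphere hx one_ne_zero), zpow_natCast, zpow_natCast, inv_pow]
    ring
  have hmoment := hasSum_circleMoment (j := j)
    (u := fun (p : ℕ × ℕ) x => c p.1 * d p.2 * x ^ (p.1 - p.2 : ℤ))
    (b := fun p => ‖c p.1‖ * ‖d p.2‖)
    (fun p => (continuousOn_zpow_sphere _).const_mul _)
    (hc.mul_of_nonneg hd (fun _ => norm_nonneg _) fun _ => norm_nonneg _)
    (fun p x hx => by simp [mem_sphere_zero_iff_norm.mp hx]) hlaurent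
  simpa only [circleMoment_const_mul, circleMoment_zpow, mul_ite, mul_one, mul_zero] using hmoment

/-- The contour shift `x ↦ q x`, carried out on Fourier coefficients. -/
theorem circleMoment_contour_shift {c d : ℕ → ℂ} {q : ℂ} (hq : ‖q‖ ≤ 1)
    (hc : Summable fun k => ‖c k‖) (hd : Summable fun l => ‖d l‖)
    (hf : ∀ x, ‖x‖ ≤ 1 → HasSum (fun k => c k * x ^ k) (f x))
    (hg : ∀ x, ‖x‖ ≤ 1 → HasSum (fun l => d l * x ^ l) (g x)) (a b : ℕ) :
    q ^ a * circleMoment (fun x => f (q * x) * g x⁻¹) (a - b) =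
      q ^ b * circleMoment (fun x => f x * g (q * x⁻¹)) (a - b) := by
  have hsummable {e : ℕ → ℂ} (he : Summable fun k => ‖e k‖) :
      Summable fun k => ‖e k * q ^ k‖ :=
    he.of_nonneg_of_le (fun _ => norm_nonneg _) fun k => by
      rw [norm_mul, norm_pow]
      exact mul_le_of_le_one_right (norm_nonneg _) (pow_le_one₀ (norm_nonneg q) hq)
  have hscale {e : ℕ → ℂ} {h : ℂ → ℂ} (hh : ∀ x, ‖x‖ ≤ 1 → HasSum (fun k => e k * x ^ k) (h x))
      (x : ℂ) (hx : x ∈ sphere (0 : ℂ) 1) :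
      HasSum (fun k => e k * q ^ k * x ^ k) (h (q * x)) := by
    simpa only [mul_pow, mul_assoc] using
      hh (q * x) (by simpa [mem_sphere_zero_iff_norm.mp hx] using hq)
  have hle {x : ℂ} (hx : x ∈ sphere (0 : ℂ) 1) : ‖x‖ ≤ 1 := (mem_sphere_zero_iff_norm.mp hx).le
  have hleft := (hasSum_circleMoment_mul_comp_inv (hsummable hc) hd (hscale hf)
    (fun x hx => hg x (hle hx)) (a - b)).mul_left (q ^ a)
  have hright := (hasSum_circleMoment_mul_comp_inv hc (hsummable hd)
    (fun x hx => hf x (hle hx)) (hscale hg) (a - b)).mul_left (q ^ b)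
  refine hleft.unique (hright.congr_fun fun p => ?_)
  split_ifs with hp
  · have hexp : a + p.1 = b + p.2 := by omega
    linear_combination (c p.1 * d p.2) * congrArg (q ^ ·) hexp
  · rw [mul_zero, mul_zero]

end CircleMoment

section PsiKernel

variable {α β q x : ℂ}

/-- The product `(x, q / x; q)_∞ / (α x, β / x; q)_∞`, whose Laurent expansion is Ramanujan's
`₁ψ₁` sum. -/
noncomputable def psiKernel (α β q x : ℂ) : ℂ :=
  qRatio 1 α q x * qRatio q β q x⁻¹

theorem norm_mul_lt_one_of_mem_sphere (hα : ‖α‖ < 1) (hx : x ∈ sphere (0 : ℂ) 1) :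
    ‖α * x‖ < 1 :=
  norm_mul_lt_one hα (mem_sphere_zero_iff_norm.mp hx).le

theorem inv_mem_sphere (hx : x ∈ sphere (0 : ℂ) 1) : x⁻¹ ∈ sphere (0 : ℂ) 1 := by
  simpa using hx

theorem continuousOn_psiKernel (hq : ‖q‖ < 1) (hα : ‖α‖ < 1) (hβ : ‖β‖ < 1) :
    ContinuousOn (psiKernel α β q) (sphere 0 1) :=
  ((continuousOn_qRatio hq 1 hα).mono sphere_subset_closedBall).mul
    ((continuousOn_qRatio hq q hβ).comp
      (continuousOn_inv₀.mono fun _ hx => ne_of_mem_sphere hx one_ne_zero)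
      fun _ hx => sphere_subset_closedBall (inv_mem_sphere hx))

theorem psiKernel_mul_left (hq : ‖q‖ < 1) (hx : ‖α * x‖ < 1) :
    psiKernel (α * q) β q x = (1 - α * x) * psiKernel α β q x := by
  rw [psiKernel, psiKernel, qRatio_mul_right hq 1 hx, mul_assoc]

theorem psiKernel_mul_pow_right (hq : ‖q‖ < 1) (hx : ‖β * x⁻¹‖ < 1) (n : ℕ) :
    psiKernel α (β * q ^ n) q x = qPoch (β * x⁻¹) q n * psiKernel α β q x := by
  rw [psiKernel, psiKernel, qRatio_mul_pow hq q hx, mul_left_comm]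

theorem psiKernel_mul_right (hq : ‖q‖ < 1) (hx : ‖β * x⁻¹‖ < 1) :
    psiKernel α (β * q) q x = (1 - β * x⁻¹) * psiKernel α β q x := by
  rw [psiKernel, psiKernel, qRatio_mul_right hq q hx, mul_left_comm]

theorem psiKernel_zero_right (hq : ‖q‖ < 1) (hx : ‖β * x⁻¹‖ < 1) :
    psiKernel α 0 q x = qPochInf (β * x⁻¹) q * psiKernel α β q x := by
  rw [psiKernel, psiKernel, qRatio_zero_right hq q hx, mul_left_comm]

theorem psiKernel_inv (hq : ‖q‖ < 1) (hx : x ≠ 0) (α β : ℂ) :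
    psiKernel α β q x⁻¹ = -(x⁻¹ * psiKernel β α q x) := by
  rw [psiKernel, psiKernel, inv_inv, qRatio_eq_one_sub_mul hq 1 α x⁻¹,
    qRatio_eq_one_sub_mul hq 1 β x, one_mul]
  field_simp
  ring

theorem qRatio_mul_qRatio_inv_mul (α β q x : ℂ) :
    qRatio 1 α q x * qRatio 1 β q (q * x⁻¹) = psiKernel α (β * q) q x := by
  rw [qRatio_comp_mul, one_mul, psiKernel]

theorem qRatio_mul_mul_qRatio_inv (hq : ‖q‖ < 1) (hx : x ≠ 0) (α β : ℂ) :
    qRatio 1 α q (q * x) * qRatio 1 β q x⁻¹ = -(x⁻¹ * psiKernel (α * q) β q x) := by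
  rw [← psiKernel_inv hq hx, ← qRatio_mul_qRatio_inv_mul, inv_inv, mul_comm]

theorem circleMoment_psiKernel_mul_left (hq : ‖q‖ < 1) (hα : ‖α‖ < 1) (hβ : ‖β‖ < 1) (j : ℤ) :
    circleMoment (psiKernel (α * q) β q) j =
      circleMoment (psiKernel α β q) j - α * circleMoment (psiKernel α β q) (j + 1) := by
  rw [← circleMoment_one_sub_mul (continuousOn_psiKernel hq hα hβ)]
  refine circleMoment_congr (fun x hx => ?_) j
  simp only [psiKernel_mul_left hq (norm_mul_lt_one_of_mem_sphere hα hx), zpow_one]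

theorem circleMoment_psiKernel_mul_right (hq : ‖q‖ < 1) (hα : ‖α‖ < 1) (hβ : ‖β‖ < 1) (j : ℤ) :
    circleMoment (psiKernel α (β * q) q) j =
      circleMoment (psiKernel α β q) j - β * circleMoment (psiKernel α β q) (j - 1) := by
  rw [sub_eq_add_neg j, ← circleMoment_one_sub_mul (continuousOn_psiKernel hq hα hβ)]
  refine circleMoment_congr (fun x hx => ?_) j
  simp only [psiKernel_mul_right hq (norm_mul_lt_one_of_mem_sphere hβ (inv_mem_sphere hx)),
    zpow_neg_one]

theorem circleMoment_neg_inv_mul (f : ℂ → ℂ) (j : ℤ) :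
    circleMoment (fun x => -(x⁻¹ * f x)) j = -circleMoment f (j - 1) := by
  rw [sub_eq_add_neg, ← circleMoment_zpow_mul]
  simpa using circleMoment_const_mul (-1) (fun x => x ^ (-1 : ℤ) * f x) j

theorem circleMoment_psiKernel_recurrence (hq : ‖q‖ < 1) (hα : ‖α‖ < 1) (hβ : ‖β‖ < 1)
    (a b : ℕ) :
    (q ^ b - α * q ^ a) * circleMoment (psiKernel α β q) (a - b) =
      (β * q ^ b - q ^ a) * circleMoment (psiKernel α β q) (a - b - 1) := by
  have hshift := circleMoment_contour_shift hq.le (summable_norm_qRatioCoeff hq 1 hα)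
    (summable_norm_qRatioCoeff hq 1 hβ)
    (fun x hx => hasSum_qRatio hq 1 (norm_mul_lt_one hα hx))
    (fun x hx => hasSum_qRatio hq 1 (norm_mul_lt_one hβ hx)) a b
  rw [circleMoment_congr fun x hx =>
      qRatio_mul_mul_qRatio_inv hq (ne_of_mem_sphere hx one_ne_zero) α β,
    circleMoment_neg_inv_mul, circleMoment_psiKernel_mul_left hq hα hβ, sub_add_cancel] at hshift
  simp only [qRatio_mul_qRatio_inv_mul] at hshift
  have hright := circleMoment_psiKernel_mul_right hq hα hβ (a - b)
  linear_combination -hshift - q ^ b * hright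

theorem circleMoment_psiKernel_q (hq : ‖q‖ < 1) (hα : ‖α‖ < 1) :
    circleMoment (psiKernel α q q) 0 = 1 := by
  have hsum := hasSum_circleMoment (j := 0) (u := fun k x => qRatioCoeff 1 α q k * x ^ (k : ℤ))
    (fun k => (continuousOn_zpow_sphere _).const_mul _) (summable_norm_qRatioCoeff hq 1 hα)
    (fun k x hx => by simp [mem_sphere_zero_iff_norm.mp hx])
    (f := psiKernel α q q)
    fun x hx => by
      have hq' : qPochInf (q * x⁻¹) q ≠ 0 :=
        qPochInf_ne_zero hq (norm_mul_lt_one_of_mem_sphere hq (inv_mem_sphere hx))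
      rw [psiKernel, qRatio, qRatio, div_self hq', mul_one, ← qRatio]
      simpa using hasSum_qRatio hq 1 (norm_mul_lt_one_of_mem_sphere hα hx)
  simp only [circleMoment_const_mul, circleMoment_zpow] at hsum
  simpa using hsum.unique (hasSum_single 0 fun k hk => by simp [hk])

theorem one_sub_mul_circleMoment_psiKernel (hq : ‖q‖ < 1) (hα : ‖α‖ < 1) (hβ : ‖β‖ < 1) :
    (1 - β) * circleMoment (psiKernel α (β * q) q) 0 =
      (1 - α * β) * circleMoment (psiKernel α β q) 0 := by
  have hrec := circleMoment_psiKernel_recurrence hq hα hβ 0 0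
  simp only [Nat.cast_zero, pow_zero, mul_one, sub_zero] at hrec
  linear_combination (1 - β) * circleMoment_psiKernel_mul_right hq hα hβ 0 - β * hrec

theorem qPoch_mul_circleMoment_psiKernel (hq : ‖q‖ < 1) (hα : ‖α‖ < 1) (hβ : ‖β‖ < 1) (n : ℕ) :
    qPoch β q n * circleMoment (psiKernel α (β * q ^ n) q) 0 =
      qPoch (α * β) q n * circleMoment (psiKernel α β q) 0 := by
  induction n with
  | zero => simp
  | succ n ih =>
    have hstep := one_sub_mul_circleMoment_psiKernel hq hα (norm_mul_pow_lt_one hq hβ n)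
    rw [mul_assoc β, ← pow_succ] at hstep
    rw [qPoch_succ, qPoch_succ]
    linear_combination (1 - α * β * q ^ n) * ih + qPoch β q n * hstep

theorem qPochInf_mul_circleMoment_psiKernel_zero (hq : ‖q‖ < 1) (hα : ‖α‖ < 1) (hβ : ‖β‖ < 1) :
    qPochInf β q * circleMoment (psiKernel α 0 q) 0 =
      qPochInf (α * β) q * circleMoment (psiKernel α β q) 0 := by
  have hcont (n : ℕ) : ContinuousOn (psiKernel α (β * q ^ n) q) (sphere 0 1) :=
    continuousOn_psiKernel hq hα (norm_mul_pow_lt_one hq hβ n)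
  obtain ⟨B, hB⟩ := (isCompact_sphere (0 : ℂ) 1).exists_bound_of_continuousOn
    (continuousOn_psiKernel hq hα hβ)
  have hβx {x : ℂ} (hx : x ∈ sphere (0 : ℂ) 1) : ‖β * x⁻¹‖ < 1 :=
    norm_mul_lt_one_of_mem_sphere hβ (inv_mem_sphere hx)
  have hbound (n : ℕ) (x : ℂ) (hx : x ∈ sphere (0 : ℂ) 1) :
      ‖psiKernel α (β * q ^ n) q x‖ ≤ Real.exp (1 - ‖q‖)⁻¹ * B := by
    rw [psiKernel_mul_pow_right hq (hβx hx), norm_mul]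
    have hq' : 0 ≤ (1 - ‖q‖)⁻¹ := inv_nonneg.mpr (sub_nonneg.mpr hq.le)
    gcongr
    · exact (norm_qPoch_le hq _ n).trans
        (Real.exp_le_exp.mpr (mul_le_of_le_one_left hq' (hβx hx).le))
    · exact hB x hx
  have hlim := tendsto_circleMoment (f := psiKernel α 0 q) (j := 0) hcont hbound fun x hx => by
    simp only [psiKernel_mul_pow_right hq (hβx hx), psiKernel_zero_right hq (hβx hx)]
    exact (tendsto_qPoch hq _).mul_const _
  exact tendsto_nhds_unique (((tendsto_qPoch hq β).mul hlim).congr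
    (qPoch_mul_circleMoment_psiKernel hq hα hβ)) ((tendsto_qPoch hq (α * β)).mul_const _)

theorem circleMoment_psiKernel_eq (hq : ‖q‖ < 1) (hα : ‖α‖ < 1) (hβ : ‖β‖ < 1) :
    circleMoment (psiKernel α β q) 0 =
      qPochInf β q * qPochInf (α * q) q / (qPochInf (α * β) q * qPochInf q q) := by
  have h := qPochInf_mul_circleMoment_psiKernel_zero hq hα hβ
  have hbase := qPochInf_mul_circleMoment_psiKernel_zero hq hα hq
  rw [circleMoment_psiKernel_q hq hα, mul_one] at hbase
  have hαβ := qPochInf_ne_zero hq (norm_mul_lt_one hα hβ.le)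
  have hqq := qPochInf_ne_zero hq hq
  rw [eq_div_iff (mul_ne_zero hαβ hqq)]
  linear_combination qPochInf β q * hbase - qPochInf q q * h

end PsiKernel

section PastroPolynomials

variable {α β q x z t : ℂ}

theorem genFun_eq_qRatio_mul_qRatio (α β q z t : ℂ) :
    genFun α β q z t = qRatio α 1 q (t * z) * qRatio β 1 q (t * z⁻¹) := by
  rw [genFun, qRatio, qRatio, div_mul_div_comm]
  simp only [one_mul, mul_assoc]

theorem hasSum_genFun (hq : ‖q‖ < 1) (α β : ℂ) (hz : ‖t * z‖ < 1) (hz' : ‖t * z⁻¹‖ < 1) :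
    HasSum (fun n => (∑ p ∈ antidiagonal n,
      qRatioCoeff α 1 q p.1 * qRatioCoeff β 1 q p.2 * (z ^ p.1 * z⁻¹ ^ p.2)) * t ^ n)
      (genFun α β q z t) := by
  rw [← one_mul (t * z)] at hz
  rw [← one_mul (t * z⁻¹)] at hz'
  have hs := summable_norm_qRatioCoeff_mul_pow hq α hz
  have hs' := summable_norm_qRatioCoeff_mul_pow hq β hz'
  have hprod := (summable_norm_sum_mul_antidiagonal_of_summable_norm hs hs').of_norm.hasSum
  rw [← tsum_mul_tsum_eq_tsum_sum_antidiagonal_of_summable_norm hs hs',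
    (hasSum_qRatio hq α hz).tsum_eq, (hasSum_qRatio hq β hz').tsum_eq,
    ← genFun_eq_qRatio_mul_qRatio] at hprod
  refine hprod.congr_fun fun n => ?_
  rw [sum_mul]
  refine sum_congr rfl fun p hp => ?_
  rw [← mem_antidiagonal.mp hp, mul_pow, mul_pow, pow_add]
  ring

theorem C_eq_sum (hq : ‖q‖ < 1) (α β z : ℂ) (n : ℕ) :
    C α β q n z = ∑ p ∈ antidiagonal n,
      qRatioCoeff α 1 q p.1 * qRatioCoeff β 1 q p.2 * (z ^ p.1 * z⁻¹ ^ p.2) := by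
  have hseries : HasFPowerSeriesAt (genFun α β q z) (FormalMultilinearSeries.ofScalars ℂ
      fun n => ∑ p ∈ antidiagonal n,
        qRatioCoeff α 1 q p.1 * qRatioCoeff β 1 q p.2 * (z ^ p.1 * z⁻¹ ^ p.2)) 0 := by
    have hsmall (w : ℂ) : ∀ᶠ t in 𝓝 (0 : ℂ), ‖t * w‖ < 1 :=
      (continuous_id.mul continuous_const).norm.continuousAt.eventually_lt_const (by simp)
    rw [hasFPowerSeriesAt_iff]
    filter_upwards [hsmall z, hsmall z⁻¹] with t hz hz'
    simpa [mul_comm] using hasSum_genFun hq α β hz hz'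
  have hunique := hseries.analyticAt.hasFPowerSeriesAt.eq_formalMultilinearSeries hseries
  simpa [C] using congrArg (fun p => FormalMultilinearSeries.coeff p n) hunique

theorem hasSum_C (hq : ‖q‖ < 1) (α β : ℂ) (hz : ‖z‖ = 1) (ht : ‖t‖ < 1) :
    HasSum (fun n => C α β q n z * t ^ n) (genFun α β q z t) := by
  simpa only [C_eq_sum hq] using hasSum_genFun hq α β (z := z) (by simpa [hz]) (by simpa [hz])

/-- The polynomial `∑ (α; q)_k (β; q)_l / ((q; q)_k (q; q)_l) * x ^ k`, over `k + l = n`, which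
represents `C α β q n z` in the variable `x = z ^ 2`. Up to normalization it is Pastro's
biorthogonal polynomial of degree `n` on the unit circle. -/
noncomputable def pastro (α β q : ℂ) (n : ℕ) (x : ℂ) : ℂ :=
  ∑ p ∈ antidiagonal n, qRatioCoeff α 1 q p.1 * qRatioCoeff β 1 q p.2 * x ^ p.1

theorem continuous_pastro (α β q : ℂ) (n : ℕ) : Continuous (pastro α β q n) := by
  unfold pastro
  fun_prop

theorem pastro_inv (hx : x ≠ 0) (α β q : ℂ) (n : ℕ) :
    pastro α β q n x⁻¹ = x ^ (-n : ℤ) * pastro β α q n x := by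
  rw [pastro, pastro, ← Nat.sum_antidiagonal_swap, mul_sum]
  refine sum_congr rfl fun p hp => ?_
  have hpow : x⁻¹ ^ p.2 = x ^ (-n : ℤ) * x ^ p.1 := by
    rw [inv_pow, ← zpow_natCast, ← zpow_natCast, ← zpow_neg, ← zpow_add₀ hx,
      ← mem_antidiagonal.mp hp]
    congr 1
    push_cast
    ring
  simp only [Prod.fst_swap, Prod.snd_swap]
  rw [hpow]
  ring

theorem C_eq_pastro (hq : ‖q‖ < 1) (hz : z ≠ 0) (α β : ℂ) (n : ℕ) :
    C α β q n z = z⁻¹ ^ n * pastro α β q n (z ^ 2) := by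
  rw [C_eq_sum hq, pastro, mul_sum]
  refine sum_congr rfl fun p hp => ?_
  have hpow : z⁻¹ ^ n * (z ^ 2) ^ p.1 = z ^ p.1 * z⁻¹ ^ p.2 := by
    rw [← mem_antidiagonal.mp hp, pow_add, inv_pow, sq, mul_pow]
    field_simp
  rw [← hpow]
  ring

theorem circleMoment_pastro_mul {f : ℂ → ℂ} (hf : ContinuousOn f (sphere 0 1)) (α β q : ℂ)
    (n : ℕ) (j : ℤ) :
    circleMoment (fun x => pastro α β q n x * f x) j = ∑ p ∈ antidiagonal n,
      qRatioCoeff α 1 q p.1 * qRatioCoeff β 1 q p.2 * circleMoment f (j + p.1) := by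
  simpa only [pastro, zpow_natCast] using circleMoment_sum_mul (antidiagonal n)
    (fun p => qRatioCoeff α 1 q p.1 * qRatioCoeff β 1 q p.2) (fun p => (p.1 : ℤ)) hf j

/-- The moments of `pastro α β q n` against the kernel `psiKernel α β q`. -/
noncomputable def pastroMoment (α β q : ℂ) (n : ℕ) (j : ℤ) : ℂ :=
  circleMoment (fun x => pastro α β q n x * psiKernel α β q x) j

theorem continuousOn_pastro_mul_psiKernel (hq : ‖q‖ < 1) (hα : ‖α‖ < 1) (hβ : ‖β‖ < 1) (n : ℕ) :
    ContinuousOn (fun x => pastro α β q n x * psiKernel α β q x) (sphere 0 1) :=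
  (continuous_pastro α β q n).continuousOn.mul (continuousOn_psiKernel hq hα hβ)

theorem pastroMoment_eq_sum (hq : ‖q‖ < 1) (hα : ‖α‖ < 1) (hβ : ‖β‖ < 1) (n : ℕ) (j : ℤ) :
    pastroMoment α β q n j = ∑ p ∈ antidiagonal n,
      qRatioCoeff α 1 q p.1 * qRatioCoeff β 1 q p.2 * circleMoment (psiKernel α β q) (j + p.1) :=
  circleMoment_pastro_mul (continuousOn_psiKernel hq hα hβ) α β q n j

theorem pastroMoment_swap (hq : ‖q‖ < 1) (α β : ℂ) (n : ℕ) (j : ℤ) :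
    pastroMoment α β q n j = -pastroMoment β α q n (-j - n - 1) := by
  have hinv : Set.EqOn (fun x => pastro α β q n x⁻¹ * psiKernel α β q x⁻¹)
      (fun x => -(x⁻¹ * (x ^ (-n : ℤ) * (pastro β α q n x * psiKernel β α q x)))) (sphere 0 1) :=
    fun x hx => by
      have hx0 := ne_of_mem_sphere hx one_ne_zero
      simp only [pastro_inv hx0, psiKernel_inv hq hx0]
      ring
  rw [pastroMoment, ← neg_neg j,
    ← circleMoment_comp_inv (fun x => pastro α β q n x * psiKernel α β q x),
    circleMoment_congr hinv, circleMoment_neg_inv_mul, circleMoment_zpow_mul, pastroMoment]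
  congr 2
  ring

theorem one_sub_mul_sum_qRatioCoeff (hq : ‖q‖ < 1) (α β : ℂ) (u : ℕ → ℂ) (n : ℕ) :
    (1 - q ^ (n + 1)) * ∑ p ∈ antidiagonal (n + 1),
        qRatioCoeff α 1 q p.1 * qRatioCoeff β 1 q p.2 * u p.1 =
      ∑ p ∈ antidiagonal n, qRatioCoeff (α * q) 1 q p.1 * qRatioCoeff β 1 q p.2 *
        ((1 - β * q ^ p.2) * u p.1 + (q ^ p.2 - α) * u (p.1 + 1)) := by
  have hsplit : (1 - q ^ (n + 1)) * ∑ p ∈ antidiagonal (n + 1),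
        qRatioCoeff α 1 q p.1 * qRatioCoeff β 1 q p.2 * u p.1 =
      ∑ p ∈ antidiagonal (n + 1), qRatioCoeff (α * q) 1 q p.1 *
          ((1 - q ^ p.2) * qRatioCoeff β 1 q p.2) * u p.1 +
        ∑ p ∈ antidiagonal (n + 1), (qRatioCoeff (α * q) 1 q p.1 -
          q ^ p.1 * qRatioCoeff α 1 q p.1) * ((q ^ p.2 - α) * qRatioCoeff β 1 q p.2) * u p.1 := by
    rw [mul_sum, ← sum_add_distrib]
    refine sum_congr rfl fun p hp => ?_
    rw [← mem_antidiagonal.mp hp, pow_add]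
    linear_combination -(qRatioCoeff β 1 q p.2 * u p.1) *
      sub_mul_qRatioCoeff_mul_left α 1 q p.1
  rw [hsplit, Nat.sum_antidiagonal_succ', Nat.sum_antidiagonal_succ]
  simp only [qRatioCoeff_mul_left_succ hq, qRatioCoeff_succ hq, qRatioCoeff_zero, pow_zero]
  simp only [sub_self, zero_mul, mul_zero, mul_one, one_mul, zero_add,
    ← sum_add_distrib]
  exact sum_congr rfl fun p _ => by ring

theorem one_sub_mul_pastroMoment_succ (hq : ‖q‖ < 1) (hα : ‖α‖ < 1) (hβ : ‖β‖ < 1) (n a : ℕ) :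
    (1 - q ^ (n + 1)) * pastroMoment α β q (n + 1) (a - (n + 1)) =
      (1 - q ^ a) * pastroMoment (α * q) β q n (a - (n + 1)) := by
  have hαq : ‖α * q‖ < 1 := norm_mul_lt_one hα hq.le
  rw [pastroMoment_eq_sum hq hα hβ, pastroMoment_eq_sum hq hαq hβ,
    one_sub_mul_sum_qRatioCoeff hq α β fun k => circleMoment (psiKernel α β q) (a - (n + 1) + k),
    mul_sum]
  refine sum_congr rfl fun p hp => ?_
  have hindex : (a - (n + 1) + (p.1 + 1 : ℕ) : ℤ) = a - p.2 := by
    have := mem_antidiagonal.mp hp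
    omega
  have hindex' : (a - (n + 1) + p.1 : ℤ) = a - p.2 - 1 := by
    omega
  rw [circleMoment_psiKernel_mul_left hq hα hβ, hindex, hindex', sub_add_cancel]
  linear_combination qRatioCoeff (α * q) 1 q p.1 * qRatioCoeff β 1 q p.2 *
    circleMoment_psiKernel_recurrence hq hα hβ a p.2

theorem pastroMoment_sub_eq_zero (hq : ‖q‖ < 1) (hα : ‖α‖ < 1) (hβ : ‖β‖ < 1) {n a : ℕ}
    (ha : a < n) : pastroMoment α β q n (a - n) = 0 := by
  induction n generalizing α a with
  | zero => omega
  | succ n ih =>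
    refine (mul_eq_zero.mp ?_).resolve_left (one_sub_pow_succ_ne_zero hq n)
    rw [Nat.cast_succ, one_sub_mul_pastroMoment_succ hq hα hβ]
    cases a with
    | zero => simp
    | succ a =>
      rw [Nat.cast_succ, add_sub_add_right_eq_sub,
        ih (norm_mul_lt_one hα hq.le) (by omega), mul_zero]

theorem pastroMoment_eq_zero (hq : ‖q‖ < 1) (hα : ‖α‖ < 1) (hβ : ‖β‖ < 1) {n : ℕ} {j : ℤ}
    (hj : -n ≤ j) (hj0 : j < 0) : pastroMoment α β q n j = 0 := by
  have h := pastroMoment_sub_eq_zero hq hα hβ (n := n) (a := (j + n).toNat) (by omega)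
  rwa [Int.toNat_of_nonneg (by omega), add_sub_cancel_right] at h

theorem pastroMoment_zero (hq : ‖q‖ < 1) (hα : ‖α‖ < 1) (hβ : ‖β‖ < 1) (n : ℕ) :
    pastroMoment α β q n 0 = circleMoment (psiKernel (α * q ^ n) β q) 0 := by
  induction n generalizing α with
  | zero => simp [pastroMoment, pastro]
  | succ n ih =>
    have h := one_sub_mul_pastroMoment_succ hq hα hβ n (n + 1)
    rw [Nat.cast_succ, sub_self] at h
    rw [mul_left_cancel₀ (one_sub_pow_succ_ne_zero hq n) h, ih (norm_mul_lt_one hα hq.le),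
      mul_assoc, ← pow_succ']

theorem qPoch_mul_pastroMoment_zero (hq : ‖q‖ < 1) (hα : ‖α‖ < 1) (hβ : ‖β‖ < 1) (n : ℕ) :
    qPoch α q n * pastroMoment α β q n 0 =
      qPochInf α q * qPochInf β q / (qPochInf q q * qPochInf (α * β) q) *
        (qPoch (α * β) q n / (1 - α * q ^ n)) := by
  have hαβ := norm_mul_lt_one hα hβ.le
  have hn := norm_mul_pow_lt_one hq hα n
  rw [pastroMoment_zero hq hα hβ, circleMoment_psiKernel_eq hq hn hβ,
    qPochInf_eq_qPoch_mul hq α n, qPochInf_eq_one_sub_mul hq (α * q ^ n),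
    qPochInf_eq_qPoch_mul hq (α * β) n, mul_right_comm α]
  have hden := one_sub_mul_pow_ne_zero hq hα n
  have hfin := qPoch_ne_zero hq hαβ n
  field_simp

end PastroPolynomials

section Orthogonality

variable {α β q : ℂ} {m n : ℕ}

theorem integral_comp_exp_mul_I (F : ℂ → ℂ) :
    ∫ θ in 0..2 * π, F (exp (I * θ)) = 2 * π * Real.circleAverage F 0 1 := by
  have hπ : (2 * π : ℂ) ≠ 0 := by simp [Real.pi_ne_zero]
  simp only [Real.circleAverage_def, circleMap_zero, ofReal_one, one_mul, mul_comm I, real_smul]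
  push_cast
  rw [mul_inv_cancel_left₀ hπ]

theorem weight_eq_mul_psiKernel (hq : ‖q‖ < 1) (α β : ℂ) (θ : ℝ) :
    weight α β q θ = (1 - (exp (I * θ) ^ 2)⁻¹) * psiKernel α β q (exp (I * θ) ^ 2) := by
  have hexp : exp (2 * I * θ) = exp (I * θ) ^ 2 := by rw [← exp_nat_mul]; congr 1; push_cast; ring
  have hexp' : exp (-2 * I * θ) = (exp (I * θ) ^ 2)⁻¹ := by rw [← hexp, ← exp_neg]; congr 1; ring
  rw [weight, hexp, hexp', mul_div_mul_comm, psiKernel, mul_left_comm]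
  simpa only [qRatio, one_mul] using
    congrArg _ (qRatio_eq_one_sub_mul hq 1 β (exp (I * θ) ^ 2)⁻¹)

/-- The integrand of the orthogonality relation in the variable `x = e ^ (2 i θ)`, up to the factor
`e ^ (-i (m + n) θ)`. The factor `1 - x⁻¹` is the quotient of the weight by `psiKernel`. -/
noncomputable def pastroProduct (α β q : ℂ) (m n : ℕ) (x : ℂ) : ℂ :=
  pastro α β q m x * ((1 - x⁻¹) * (pastro α β q n x * psiKernel α β q x))

theorem continuousOn_one_sub_inv_mul {f : ℂ → ℂ} (hf : ContinuousOn f (sphere 0 1)) :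
    ContinuousOn (fun x => (1 - x⁻¹) * f x) (sphere 0 1) :=
  (continuousOn_const.sub
    (continuousOn_inv₀.mono fun _ hx => ne_of_mem_sphere hx one_ne_zero)).mul hf

theorem continuousOn_pastroProduct (hq : ‖q‖ < 1) (hα : ‖α‖ < 1) (hβ : ‖β‖ < 1) (m n : ℕ) :
    ContinuousOn (pastroProduct α β q m n) (sphere 0 1) :=
  (continuous_pastro α β q m).continuousOn.mul
    (continuousOn_one_sub_inv_mul (continuousOn_pastro_mul_psiKernel hq hα hβ n))

theorem C_mul_C_mul_weight (hq : ‖q‖ < 1) (α β : ℂ) (m n : ℕ) (θ : ℝ) :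
    C α β q m (exp (I * θ)) * C α β q n (exp (I * θ)) * weight α β q θ =
      pastroProduct α β q m n (exp (I * θ) ^ 2) * exp (I * θ) ^ (-(m + n) : ℤ) := by
  have hz := exp_ne_zero (I * θ)
  rw [C_eq_pastro hq hz, C_eq_pastro hq hz, weight_eq_mul_psiKernel hq, pastroProduct, zpow_neg,
    zpow_add₀ hz, zpow_natCast, zpow_natCast, mul_inv, inv_pow, inv_pow]
  ring

theorem integral_C_mul_C_mul_weight (hq : ‖q‖ < 1) (α β : ℂ) (m n : ℕ) :
    ∫ θ in 0..2 * π, C α β q m (exp (I * θ)) * C α β q n (exp (I * θ)) * weight α β q θ =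
      2 * π * circleMoment (fun z => pastroProduct α β q m n (z ^ 2)) (-(m + n)) := by
  simp only [C_mul_C_mul_weight hq]
  exact integral_comp_exp_mul_I
    fun z => pastroProduct α β q m n (z ^ 2) * z ^ (-(m + n) : ℤ)

theorem intervalIntegrable_C_mul_C_mul_weight (hq : ‖q‖ < 1) (hα : ‖α‖ < 1) (hβ : ‖β‖ < 1)
    (m n : ℕ) (a b : ℝ) :
    IntervalIntegrable (fun θ : ℝ =>
      C α β q m (exp (I * θ)) * C α β q n (exp (I * θ)) * weight α β q θ) volume a b := by
  simp only [C_mul_C_mul_weight hq]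
  refine Continuous.intervalIntegrable (.mul ?_ ?_) a b
  · exact (continuousOn_pastroProduct hq hα hβ m n).comp_continuous (by fun_prop) fun θ => by
      simp [mul_comm I]
  · exact (by fun_prop : Continuous fun θ : ℝ => exp (I * θ)).zpow₀ _ fun θ => .inl (exp_ne_zero _)

theorem circleMoment_pastroProduct (hq : ‖q‖ < 1) (hα : ‖α‖ < 1) (hβ : ‖β‖ < 1)
    (m n : ℕ) (j : ℤ) :
    circleMoment (pastroProduct α β q m n) j = ∑ p ∈ antidiagonal m,
      qRatioCoeff α 1 q p.1 * qRatioCoeff β 1 q p.2 *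
        (pastroMoment α β q n (j + p.1) - pastroMoment α β q n (j + p.1 - 1)) := by
  have hcont := continuousOn_pastro_mul_psiKernel hq hα hβ n
  have hshift (k : ℤ) :
      circleMoment (fun x => (1 - x⁻¹) * (pastro α β q n x * psiKernel α β q x)) k =
        pastroMoment α β q n k - pastroMoment α β q n (k - 1) := by
    simpa only [pastroMoment, one_mul, zpow_neg_one, ← sub_eq_add_neg] using
      circleMoment_one_sub_mul hcont 1 (-1) k
  simp only [← hshift]
  exact circleMoment_pastro_mul (continuousOn_one_sub_inv_mul hcont) α β q m j

theorem circleMoment_pastroProduct_of_lt (hq : ‖q‖ < 1) (hα : ‖α‖ < 1) (hβ : ‖β‖ < 1)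
    {s : ℕ} (hmn : m < n) (hs : m + n = 2 * s) :
    circleMoment (pastroProduct α β q m n) (-s) = 0 := by
  rw [circleMoment_pastroProduct hq hα hβ]
  refine sum_eq_zero fun p hp => ?_
  have := mem_antidiagonal.mp hp
  rw [pastroMoment_eq_zero hq hα hβ (by omega) (by omega),
    pastroMoment_eq_zero hq hα hβ (by omega) (by omega), sub_zero, mul_zero]

theorem circleMoment_pastroProduct_self (hq : ‖q‖ < 1) (hα : ‖α‖ < 1) (hβ : ‖β‖ < 1) (n : ℕ) :
    qPoch q q n * circleMoment (pastroProduct α β q n n) (-n) =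
      qPoch α q n * pastroMoment α β q n 0 + qPoch β q n * pastroMoment β α q n 0 := by
  have hfirst : ∑ p ∈ antidiagonal n, qRatioCoeff α 1 q p.1 * qRatioCoeff β 1 q p.2 *
      pastroMoment α β q n (-n + p.1) = qRatioCoeff α 1 q n * pastroMoment α β q n 0 := by
    rw [sum_eq_single_of_mem (n, 0) (by simp) fun p hp hne => ?_]
    · simp
    · have := mem_antidiagonal.mp hp
      have : p.1 ≠ n := fun h => hne (Prod.ext h (by dsimp only; omega))
      rw [pastroMoment_eq_zero hq hα hβ (by omega) (by omega), mul_zero]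
  have hsecond : ∑ p ∈ antidiagonal n, qRatioCoeff α 1 q p.1 * qRatioCoeff β 1 q p.2 *
      pastroMoment α β q n (-n + p.1 - 1) = -(qRatioCoeff β 1 q n * pastroMoment β α q n 0) := by
    rw [sum_eq_single_of_mem (0, n) (by simp) fun p hp hne => ?_]
    · simp [pastroMoment_swap hq α β]
    · have := mem_antidiagonal.mp hp
      have : p.1 ≠ 0 := fun h => hne (Prod.ext h (by dsimp only; omega))
      rw [pastroMoment_eq_zero hq hα hβ (by omega) (by omega), mul_zero]
  have hn := qPoch_ne_zero hq hq n
  simp only [circleMoment_pastroProduct hq hα hβ, mul_sub, sum_sub_distrib]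
  rw [hfirst, hsecond, qRatioCoeff_one_right, qRatioCoeff_one_right]
  field_simp
  ring

theorem integral_C_mul_C_mul_weight_of_lt (hq : ‖q‖ < 1) (hα : ‖α‖ < 1) (hβ : ‖β‖ < 1)
    (hmn : m < n) :
    ∫ θ in 0..2 * π, C α β q m (exp (I * θ)) * C α β q n (exp (I * θ)) * weight α β q θ = 0 := by
  rw [integral_C_mul_C_mul_weight hq]
  obtain hs | hodd := (m + n).even_or_odd
  · obtain ⟨s, hs⟩ := hs.two_dvd
    have hexp : (-(m + n) : ℤ) = 2 * -s := by omega
    rw [hexp, circleMoment_comp_sq_two_mul (continuousOn_pastroProduct hq hα hβ m n),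
      circleMoment_pastroProduct_of_lt hq hα hβ hmn hs, mul_zero]
  · rw [circleMoment_comp_sq_of_odd _ (by exact_mod_cast hodd.natCast.neg), mul_zero]

theorem integral_C_sq_mul_weight (hq : ‖q‖ < 1) (hα : ‖α‖ < 1) (hβ : ‖β‖ < 1) (n : ℕ) :
    ∫ θ in 0..2 * π, C α β q n (exp (I * θ)) * C α β q n (exp (I * θ)) * weight α β q θ =
      2 * π * (qPochInf α q * qPochInf β q) / (qPochInf q q * qPochInf (α * β) q) *
        (1 / (1 - α * q ^ n) + 1 / (1 - β * q ^ n)) * (qPoch (α * β) q n / qPoch q q n) := by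
  have hself := circleMoment_pastroProduct_self hq hα hβ n
  rw [qPoch_mul_pastroMoment_zero hq hα hβ, qPoch_mul_pastroMoment_zero hq hβ hα, mul_comm β α]
    at hself
  rw [integral_C_mul_C_mul_weight hq, ← two_mul, ← mul_neg, circleMoment_comp_sq_two_mul
    (continuousOn_pastroProduct hq hα hβ n n), eq_div_of_mul_eq (qPoch_ne_zero hq hq n)
    ((mul_comm _ _).trans hself)]
  ring

end Orthogonality

end QOrth

theorem theorem1p3 (q α β : ℂ) (hq : ‖q‖ < 1) (hα : ‖α‖ < 1) (hβ : ‖β‖ < 1) :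
    -- the generating function expansion that defines the functions `C_n`
    (∀ (θ : ℝ) (t : ℂ), ‖t‖ < 1 →
      HasSum (fun n : ℕ => QOrth.C α β q n (Complex.exp (Complex.I * θ)) * t ^ n)
        (QOrth.genFun α β q (Complex.exp (Complex.I * θ)) t)) ∧
    -- the orthogonality relation
    ∀ m n : ℕ,
      IntervalIntegrable
        (fun θ : ℝ => QOrth.C α β q m (Complex.exp (Complex.I * θ)) *
          QOrth.C α β q n (Complex.exp (Complex.I * θ)) * QOrth.weight α β q θ)
        MeasureTheory.volume 0 (2 * Real.pi) ∧
      ∫ θ in (0 : ℝ)..(2 * Real.pi),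
          QOrth.C α β q m (Complex.exp (Complex.I * θ)) *
            QOrth.C α β q n (Complex.exp (Complex.I * θ)) * QOrth.weight α β q θ =
        2 * (Real.pi : ℂ) * (QOrth.qPochInf α q * QOrth.qPochInf β q) /
            (QOrth.qPochInf q q * QOrth.qPochInf (α * β) q) *
          (1 / (1 - α * q ^ n) + 1 / (1 - β * q ^ n)) *
          (QOrth.qPoch (α * β) q n / QOrth.qPoch q q n) *
          (if m = n then 1 else 0) := by
  refine ⟨fun θ t ht => QOrth.hasSum_C hq α β (Complex.norm_exp_I_mul_ofReal θ) ht, fun m n =>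
    ⟨QOrth.intervalIntegrable_C_mul_C_mul_weight hq hα hβ m n 0 (2 * Real.pi), ?_⟩⟩
  split_ifs with hmn
  · rw [hmn, mul_one, QOrth.integral_C_sq_mul_weight hq hα hβ]
  · rw [mul_zero]
    rcases lt_or_gt_of_ne hmn with h | h
    · exact QOrth.integral_C_mul_C_mul_weight_of_lt hq hα hβ h
    · simpa only [mul_comm (QOrth.C α β q m _)] using
        QOrth.integral_C_mul_C_mul_weight_of_lt hq hα hβ h
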